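/- Consider the category $\mathbf{Sets}$ of all sets and all functions, regarded as a Kripke category in the first-order language of equality $\mathscr L_{=}$: the worlds are the sets, the accessibility mappings are the functions, and, writing $\mathscr L_{=}^{\Diamond}$ for the expansion of $\mathscr L_{=}$ by modal operators, $W\models\Box\varphi[\nu]$ (respectively $W\models\Diamond\varphi[\nu]$) means that $U\models\varphi[f\circ\nu]$ for every (respectively some) set $U$ and function $f\colon W\to U$, while equality, Boolean connectives and quantifiers (over the elements of the current world) are interpreted as usual. For a language $\mathscr L$ with $\mathscr L_{=}\subseteq\mathscr L\subseteq\mathscr L_{=}^{\Diamond}$ (a set of formulas of $\mathscr L_{=}^{\Diamond}$ containing all formulas of $\mathscr L_{=}$) and a world $W$, let $\mathscr L_{W}$ be the set of all assertions $\psi(a_0,\dots,a_{k-1})$ with $\psi(x_0,\dots,x_{k-1})\in\mathscr L$ and parameters $a_0,\dots,a_{k-1}\in W$, and let $\mathrm{Val}_{\mathbf{Sets}}(W,\mathscr L_{W})$ be the set of propositional modal assertions $\varphi(p_0,\dots,p_m)$ all of whose substitution instances $\varphi(\psi_0,\dots,\psi_m)$ with $\psi_0,\dots,\psi_m\in\mathscr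 L_{W}$ are true at $W$. A partition prelattice of a set $P$ is a preorder $(Q,\leq)$ whose quotient by the equivalence relation $p\leq q\leq p$ is isomorphic to the lattice of partitions of $P$ ordered by refinement (finer partitions below coarser ones). Let $\mathrm{Prepartition}_n$ be the propositional modal logic of the partition prelattices of an $n$-element set, that is, the set of propositional modal assertions that hold at every node, under every valuation, of every Kripke frame that is a partition prelattice of an $n$-element set. **Theorem.** Let $n\geq 1$. For every set $W_0$ with $|W_0|=n$ and every language $\mathscr L$, modal or not, with $\mathscr L_{=}\subseteq\mathscr L\subseteq\mathscr L_{=}^{\Diamond}$, $$\mathrm{Val}_{\mathbf{Sets}}(W_0,\mathscr L_{W_0})=\mathrm{Prepartition}_n .$$ -/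

import Mathlib

open scoped FirstOrder

universe u v w x y

namespace ModalModelTheory

/-! ### Propositional modal logic -/

/-- Propositional modal assertions, with propositional variables indexed by `ℕ`. The remaining
Boolean connectives and `◇` are the usual classical abbreviations. -/
inductive PropFormula : Type
  | var (i : ℕ) : PropFormula
  | falsum : PropFormula
  | imp (φ ψ : PropFormula) : PropFormula
  | box (φ : PropFormula) : PropFormula

namespace PropFormula

def neg (φ : PropFormula) : PropFormula := φ.imp falsum

def dia (φ : PropFormula) : PropFormula := φ.neg.box.neg

/-- Kripke semantics on the frame `(Q, R)` with valuation `V`. -/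
def Holds {Q : Type v} (R : Q → Q → Prop) (V : ℕ → Q → Prop) : PropFormula → Q → Prop
  | var i, q => V i q
  | falsum, _ => False
  | imp φ ψ, q => Holds R V φ q → Holds R V ψ q
  | box φ, q => ∀ r, R q r → Holds R V φ r

theorem holds_dia {Q : Type v} (R : Q → Q → Prop) (V : ℕ → Q → Prop) (φ : PropFormula) (q : Q) :
    φ.dia.Holds R V q ↔ ∃ r, R q r ∧ φ.Holds R V r := by
  simp [dia, neg, Holds]

/-- Validity of a propositional modal assertion in a frame: truth at every node, under every
valuation. -/
def ValidInFrame {Q : Type v} (R : Q → Q → Prop) (φ : PropFormula) : Prop :=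
  ∀ (V : ℕ → Q → Prop) (q : Q), φ.Holds R V q

end PropFormula

/-! ### Partition prelattices -/

/-- The lattice `Setoid P` of equivalence relations on `P` is the partition lattice of `P`, a
partition being given as the set of equivalence classes: the order is refinement. -/
theorem setoid_le_iff_refines {P : Type x} (r s : Setoid P) :
    r ≤ s ↔ ∀ b ∈ r.classes, ∃ c ∈ s.classes, b ⊆ c := by
  constructor
  · rintro h b ⟨a, rfl⟩
    exact ⟨_, ⟨a, rfl⟩, fun _ hy => h hy⟩
  · intro h a b hab
    obtain ⟨c, ⟨d, rfl⟩, hc⟩ := h _ ⟨b, rfl⟩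
    exact s.trans (hc hab) (s.symm (hc (r.refl b)))

/-- A preorder `Q` is a partition prelattice of `P` when its quotient by `p ≤ q ≤ p` is (up to
isomorphism) the partition lattice of `P`. -/
def IsPartitionPrelattice (P : Type x) (Q : Type v) [Preorder Q] : Prop :=
  Nonempty (Antisymmetrization Q (· ≤ ·) ≃o Setoid P)

/-- The modal logic of the frames that are partition prelattices of an `n`-element set. -/
def Prepartition (n : ℕ) : Set PropFormula :=
  {φ | ∀ (Q : Type v) [Preorder Q], IsPartitionPrelattice (Fin n) Q →
    φ.ValidInFrame (fun p q : Q => p ≤ q)}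

/-! ### First-order modal formulas -/

/-- Formulas of the first-order modal expansion of `L`, with free variables in `α` and `n` further
variables `Fin n`: the constructors of Mathlib's `BoundedFormula` together with `□`. -/
inductive ModalFormula (L : FirstOrder.Language.{u, v}) (α : Type w) : ℕ → Type (max u v w)
  | falsum {n : ℕ} : ModalFormula L α n
  | equal {n : ℕ} (t₁ t₂ : L.Term (α ⊕ Fin n)) : ModalFormula L α n
  | rel {n l : ℕ} (R : L.Relations l) (ts : Fin l → L.Term (α ⊕ Fin n)) : ModalFormula L α n
  | imp {n : ℕ} (φ ψ : ModalFormula L α n) : ModalFormula L α n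
  | all {n : ℕ} (φ : ModalFormula L α (n + 1)) : ModalFormula L α n
  | box {n : ℕ} (φ : ModalFormula L α n) : ModalFormula L α n

namespace ModalFormula

variable {L : FirstOrder.Language.{u, v}} {α : Type w} {β : Type x}

def neg {n : ℕ} (φ : ModalFormula L α n) : ModalFormula L α n := φ.imp falsum

def dia {n : ℕ} (φ : ModalFormula L α n) : ModalFormula L α n := φ.neg.box.neg

/-- The non-modal first-order formulas, as modal formulas. -/
def ofFirstOrder : {n : ℕ} → L.BoundedFormula α n → ModalFormula L α n
  | _, .falsum => falsum
  | _, .equal t₁ t₂ => equal t₁ t₂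
  | _, .rel R ts => rel R ts
  | _, .imp φ ψ => imp (ofFirstOrder φ) (ofFirstOrder ψ)
  | _, .all φ => all (ofFirstOrder φ)

/-- Replace the free variables `α` along `g`. -/
def relabel (g : α → β) : {n : ℕ} → ModalFormula L α n → ModalFormula L β n
  | _, falsum => falsum
  | _, equal t₁ t₂ => equal (t₁.relabel (Sum.map g id)) (t₂.relabel (Sum.map g id))
  | _, rel R ts => rel R fun i => (ts i).relabel (Sum.map g id)
  | _, imp φ ψ => imp (relabel g φ) (relabel g ψ)
  | _, all φ => all (relabel g φ)
  | _, box φ => box (relabel g φ)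

end ModalFormula

/-- The substitution instance `φ(ψ₀, ψ₁, …)` of a propositional modal assertion `φ`. -/
def PropFormula.subst {L : FirstOrder.Language.{u, v}} {α : Type w} (ψ : ℕ → ModalFormula L α 0) :
    PropFormula → ModalFormula L α 0
  | .var i => ψ i
  | .falsum => .falsum
  | .imp φ χ => .imp (φ.subst ψ) (χ.subst ψ)
  | .box φ => .box (φ.subst ψ)

/-! ### Kripke categories -/

/-- A concrete category of `L`-structures, whose morphisms are `L`-homomorphisms. -/
structure KripkeCategory (L : FirstOrder.Language.{u, v}) where
  World : Type w
  carrier : World → Type x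
  str : ∀ W, L.Structure (carrier W)
  Hom : ∀ W U, Set (carrier W →[L] carrier U)
  id_mem : ∀ W, FirstOrder.Language.Hom.id L (carrier W) ∈ Hom W W
  comp_mem : ∀ {W U V} {f : carrier W →[L] carrier U} {g : carrier U →[L] carrier V},
    f ∈ Hom W U → g ∈ Hom U V → g.comp f ∈ Hom W V

attribute [instance] KripkeCategory.str

namespace KripkeCategory

variable {L : FirstOrder.Language.{u, v}} (C : KripkeCategory.{u, v, w, x} L) {α : Type y}

/-- Satisfaction at the world `W` under the assignment `ν` of the free variables and `xs` of the
other ones. Individuals are carried along the accessibility mappings. -/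
def Sat : {n : ℕ} → (W : C.World) → ModalFormula L α n → (α → C.carrier W) →
    (Fin n → C.carrier W) → Prop
  | _, _, .falsum, _, _ => False
  | _, _, .equal t₁ t₂, ν, xs => t₁.realize (Sum.elim ν xs) = t₂.realize (Sum.elim ν xs)
  | _, _, .rel R ts, ν, xs =>
      FirstOrder.Language.Structure.RelMap R fun i => (ts i).realize (Sum.elim ν xs)
  | _, W, .imp φ ψ, ν, xs => Sat W φ ν xs → Sat W ψ ν xs
  | _, W, .all φ, ν, xs => ∀ a : C.carrier W, Sat W φ ν (Fin.snoc xs a)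
  | _, W, .box φ, ν, xs => ∀ (U : C.World), ∀ f ∈ C.Hom W U, Sat U φ (f ∘ ν) (f ∘ xs)

theorem sat_dia {n : ℕ} (W : C.World) (φ : ModalFormula L α n) (ν : α → C.carrier W)
    (xs : Fin n → C.carrier W) :
    C.Sat W φ.dia ν xs ↔ ∃ U, ∃ f ∈ C.Hom W U, C.Sat U φ (f ∘ ν) (f ∘ xs) := by
  simp [ModalFormula.dia, ModalFormula.neg, Sat]

/-- An assertion with parameters from `W` is a formula whose free variables are the individuals of
`W`, each standing for itself. This says that the assertion is true at `W`. -/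
def TrueAt (W : C.World) (φ : ModalFormula L (C.carrier W) 0) : Prop :=
  C.Sat W φ id Fin.elim0

/-- The assertions `ψ(a₀, …, aₖ₋₁)` with `ψ(x₀, …, xₖ₋₁)` a formula of the language `𝓛` and
parameters `a₀, …, aₖ₋₁` from the world `W`. -/
def withParameters (W : C.World) (𝓛 : ∀ k : ℕ, Set (ModalFormula L (Fin k) 0)) :
    Set (ModalFormula L (C.carrier W) 0) :=
  {χ | ∃ (k : ℕ) (ψ : ModalFormula L (Fin k) 0) (a : Fin k → C.carrier W),
    ψ ∈ 𝓛 k ∧ χ = ψ.relabel a}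

/-- The propositional modal assertions that are valid at `W` with respect to substitution instances
from `Γ`. -/
def Val (W : C.World) (Γ : Set (ModalFormula L (C.carrier W) 0)) : Set PropFormula :=
  {φ | ∀ ψ : ℕ → ModalFormula L (C.carrier W) 0, (∀ i, ψ i ∈ Γ) → C.TrueAt W (φ.subst ψ)}

end KripkeCategory

/-- The Kripke category of all sets and all functions, in the language of equality. -/
def Sets : KripkeCategory.{0, 0, u + 1, u} FirstOrder.Language.empty where
  World := Type u
  carrier W := W
  str _ := FirstOrder.Language.emptyStructure
  Hom _ _ := Set.univ
  id_mem _ := Set.mem_univ _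
  comp_mem _ _ := Set.mem_univ _

end ModalModelTheory

/-!
# Modal validities of a finite set in the category of sets

A node reachable from an `n`-element world `W₀` is a world `U` with a map `f : W₀ → U`. As `W₀` is
nonempty, `(V, g)` is accessible from `(U, f)` exactly when `g` factors through `f`, that is, when
`ker f ≤ ker g`. So the reachable nodes are preordered by kernels, and they form a (large)
partition prelattice of `W₀`.

*Every formula of `Prepartition n` is valid at `W₀`.* Given the substituted assertions `ψ i`,
identify two nodes when they have the same kernel and give the same truth values to all `ψ i`. The
resulting quotient is a partition prelattice of `Fin n` living in an arbitrary universe, and the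
quotient map is a bounded morphism.

*Every formula valid at `W₀` is in `Prepartition n`.* Suppose that `φ` fails at a node `q` of a
partition prelattice `Q`, and let `e` be the partition given by `q`. Only finitely many variables
occur in `φ`, so within one cluster of `Q` only finitely many kinds of node can be told apart. Each
kind is coded by a finite cardinality larger than `n`. The node `(U, f)` is sent into the cluster
of `ker f ⊔ e`, to a node of the kind that the cardinality of `U` codes; a `U` whose cardinality
codes nothing, such as `W₀`, yields `q` in the cluster of `e`. Since `p ↦ p ⊔ e` is a bounded
morphism onto the cone above `e`, and every coded cardinality can be attained over every larger
kernel, this is a bounded morphism up to the kind of a node. The induced valuation is first-order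
definable in the language of equality (`exists_formula_realize_iff`), because finitely many
equalities between parameters describe the kernel and counting quantifiers describe the
cardinality. Hence already first-order instances of `φ` fail at `W₀`.

Both halves transfer truth along the morphism by `sat_subst_iff_holds`.
-/

namespace ModalModelTheory

/-! ### Propositional variables -/

/-- The propositional variables that occur in a propositional modal assertion. -/
def PropFormula.vars : PropFormula → Finset ℕ
  | .var i => {i}
  | .falsum => ∅
  | .imp φ ψ => φ.vars ∪ ψ.vars
  | .box φ => φ.vars

/-- Two nodes of one cluster that agree on the propositional variables satisfy the same
formulas, as they see the same nodes. -/
theorem PropFormula.holds_congr_of_equiv {Q : Type v} [Preorder Q] (V : ℕ → Q → Prop)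
    {q r : Q} (hqr : q ≤ r) (hrq : r ≤ q) :
    ∀ φ : PropFormula, (∀ i ∈ φ.vars, V i q ↔ V i r) →
      (φ.Holds (fun p q : Q => p ≤ q) V q ↔ φ.Holds (fun p q : Q => p ≤ q) V r)
  | .var i, h => h i (by simp [vars])
  | .falsum, _ => Iff.rfl
  | .imp φ ψ, h => imp_congr
      (holds_congr_of_equiv V hqr hrq φ fun i hi => h i (by simp [vars, hi]))
      (holds_congr_of_equiv V hqr hrq ψ fun i hi => h i (by simp [vars, hi]))
  | .box _, _ => ⟨fun H s hs => H s (hqr.trans hs), fun H s hs => H s (hrq.trans hs)⟩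

/-! ### Partition prelattices as preorders induced from the partition lattice -/

theorem isPartitionPrelattice_iff {P : Type x} {Q : Type v} [Preorder Q] :
    IsPartitionPrelattice P Q ↔
      ∃ c : Q → Setoid P, Function.Surjective c ∧ ∀ p q, c p ≤ c q ↔ p ≤ q := by
  constructor
  · rintro ⟨e⟩
    refine ⟨fun q => e (toAntisymmetrization (· ≤ ·) q), fun s => ?_, fun p q => ?_⟩
    · obtain ⟨q, hq⟩ := Quotient.exists_rep (e.symm s)
      exact ⟨q, e.symm_apply_eq.1 hq.symm |>.symm⟩
    · rw [e.le_iff_le, toAntisymmetrization_le_toAntisymmetrization_iff]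
  · rintro ⟨c, hc, hle⟩
    have hmono : Monotone c := fun p q h => (hle p q).2 h
    let f : Antisymmetrization Q (· ≤ ·) → Setoid P :=
      Quotient.lift c fun p q h => le_antisymm (hmono h.1) (hmono h.2)
    have hf : ∀ p q, f p ≤ f q ↔ p ≤ q := fun p q =>
      Quotient.inductionOn₂ p q fun p q => hle p q
    exact ⟨RelIso.ofSurjective (OrderEmbedding.ofMapLEIff f hf) fun s =>
      (hc s).imp' (toAntisymmetrization (· ≤ ·)) fun _ h => h⟩

/-! ### Transfer of truth between sets and preorders -/

/-- Truth of substitution instances at the nodes `(U, f : W₀ → U)` agrees with truth in a Kripke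
model on a preorder along a map that is a bounded morphism up to passing to an equivalent node
with the same values of the relevant variables. -/
theorem sat_subst_iff_holds {W₀ : Sets.{u}.World} {Q : Type v} [Preorder Q]
    (V : ℕ → Q → Prop) (ψ : ℕ → ModalFormula FirstOrder.Language.empty (Sets.carrier W₀) 0)
    (node : ∀ U : Sets.{u}.World, (Sets.carrier W₀ → Sets.carrier U) → Q) (S : Finset ℕ)
    (atom : ∀ i ∈ S, ∀ U f, Sets.Sat U (ψ i) f Fin.elim0 ↔ V i (node U f))
    (forth : ∀ (U U' : Sets.{u}.World) (f : Sets.carrier W₀ → Sets.carrier U)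
      (h : Sets.carrier U → Sets.carrier U'), node U f ≤ node U' (h ∘ f))
    (back : ∀ (U : Sets.{u}.World) (f : Sets.carrier W₀ → Sets.carrier U) (r : Q),
      node U f ≤ r → ∃ (U' : Sets.{u}.World) (h : Sets.carrier U → Sets.carrier U'),
        node U' (h ∘ f) ≤ r ∧ r ≤ node U' (h ∘ f) ∧ ∀ i ∈ S, V i (node U' (h ∘ f)) ↔ V i r) :
    ∀ φ : PropFormula, φ.vars ⊆ S → ∀ U f,
      Sets.Sat U (φ.subst ψ) f Fin.elim0 ↔ φ.Holds (fun p q : Q => p ≤ q) V (node U f)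
  | .var i, hS, U, f => atom i (hS (by simp [PropFormula.vars])) U f
  | .falsum, _, _, _ => Iff.rfl
  | .imp φ χ, hS, U, f => imp_congr
      (sat_subst_iff_holds V ψ node S atom forth back φ (Finset.union_subset_left hS) U f)
      (sat_subst_iff_holds V ψ node S atom forth back χ (Finset.union_subset_right hS) U f)
  | .box φ, hS, U, f => by
      have ih := sat_subst_iff_holds V ψ node S atom forth back φ hS
      have sat_box : Sets.Sat U ((PropFormula.box φ).subst ψ) f Fin.elim0 ↔
          ∀ (U' : Sets.{u}.World) (h : Sets.carrier U → Sets.carrier U'),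
            Sets.Sat U' (φ.subst ψ) (h ∘ f) Fin.elim0 := by
        -- In the language of equality every function is a homomorphism.
        refine ⟨fun H U' h => ?_, fun H U' h _ => ?_⟩
        · have := H U' (⟨h, fun {_} F => isEmptyElim F, fun {_} R => isEmptyElim R⟩)
            (Set.mem_univ _)
          rwa [Subsingleton.elim (_ ∘ Fin.elim0) Fin.elim0] at this
        · rw [Subsingleton.elim (_ ∘ Fin.elim0) Fin.elim0]
          exact H U' h
      rw [sat_box]
      constructor
      · intro H r hr
        obtain ⟨U', h, h₁, h₂, h₃⟩ := back U f r hr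
        exact (φ.holds_congr_of_equiv V h₁ h₂ fun i hi => h₃ i (hS hi)).1
          ((ih U' _).1 (H U' h))
      · intro H U' h
        exact (ih U' _).2 (H _ (forth U U' f h))

/-! ### Kernels -/

theorem ker_le_ker_comp {α : Type u} {β : Type v} {γ : Type w} (f : α → β) (h : β → γ) :
    Setoid.ker f ≤ Setoid.ker (h ∘ f) :=
  fun _ _ hxy => congrArg h hxy

theorem exists_comp_eq_of_ker_le {α : Type u} {β : Type v} {γ : Type w} [Nonempty γ]
    {f : α → β} {g : α → γ} (h : Setoid.ker f ≤ Setoid.ker g) : ∃ e : β → γ, e ∘ f = g := by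
  have hfg : Function.FactorsThrough g f := fun _ _ hxy => h hxy
  obtain ⟨e, he⟩ := (Function.factorsThrough_iff g).1 hfg
  exact ⟨e, he.symm⟩

/-- Every partition of `Fin n` is the kernel of a map to a set of any given size `N ≥ n`. -/
theorem exists_ker_eq {n N : ℕ} (hN : n ≤ N) (π : Setoid (Fin n)) :
    ∃ g : Fin n → ULift.{u} (Fin N), Setoid.ker g = π := by
  refine ⟨fun x => ⟨Fin.castLE hN (Quotient.out (⟦x⟧ : Quotient π))⟩, Setoid.ext fun x y => ?_⟩
  rw [Setoid.ker_def, ULift.up_inj, (Fin.castLE_injective hN).eq_iff, Quotient.out_inj]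
  exact Quotient.eq

/-! ### Formulas of `Prepartition n` are valid -/

/-- If `φ` is valid on the partition prelattices of an `n`-element set, then all its substitution
instances, with arbitrary assertions, are true at an `n`-element set. -/
theorem trueAt_subst_of_mem_prepartition {n : ℕ} (hn : 0 < n) {W₀ : Sets.{u}.World}
    (a : Fin n ≃ Sets.carrier W₀) {φ : PropFormula} (hφ : φ ∈ Prepartition.{v} n)
    (ψ : ℕ → ModalFormula FirstOrder.Language.empty (Sets.carrier W₀) 0) :
    Sets.TrueAt W₀ (φ.subst ψ) := by
  -- Nodes `(U, f)` up to the kernel and the truth values of the assertions `ψ i`.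
  let Q : Type v := ULift.{v} {p : Setoid (Fin n) × (ℕ → Prop) //
    ∃ (U : Sets.{u}.World) (f : Sets.carrier W₀ → Sets.carrier U),
      (Setoid.ker (f ∘ a), fun i => Sets.Sat U (ψ i) f Fin.elim0) = p}
  let c : Q → Setoid (Fin n) := fun q => q.down.1.1
  let _ : Preorder Q := Preorder.lift c
  let V : ℕ → Q → Prop := fun i q => q.down.1.2 i
  let node : ∀ U : Sets.{u}.World, (Sets.carrier W₀ → Sets.carrier U) → Q :=
    fun U f => ⟨⟨(Setoid.ker (f ∘ a), fun i => Sets.Sat U (ψ i) f Fin.elim0), U, f, rfl⟩⟩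
  have hQ : IsPartitionPrelattice (Fin n) Q := by
    refine isPartitionPrelattice_iff.2 ⟨c, fun π => ?_, fun _ _ => Iff.rfl⟩
    obtain ⟨g, hg⟩ := exists_ker_eq.{u} le_rfl π
    refine ⟨node (ULift.{u} (Fin n)) (g ∘ a.symm), ?_⟩
    change Setoid.ker ((g ∘ a.symm) ∘ a) = π
    rw [Function.comp_assoc, a.symm_comp_self, Function.comp_id, hg]
  refine (sat_subst_iff_holds V ψ node φ.vars (fun _ _ _ _ => Iff.rfl) ?_ ?_ φ subset_rfl
    W₀ id).2 (hφ Q hQ V _)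
  · exact fun U U' f h => ker_le_ker_comp (f ∘ a) h
  · rintro U f ⟨⟨_, U', g, rfl⟩⟩ hr
    have : Nonempty (Sets.carrier U') := ⟨g (a ⟨0, hn⟩)⟩
    obtain ⟨h, hh⟩ := exists_comp_eq_of_ker_le (f := f ∘ a) (g := g ∘ a) hr
    have hfg : h ∘ f = g := a.surjective.injective_comp_right hh
    exact ⟨U', h, by rw [hfg], by rw [hfg], fun i _ => by rw [hfg]⟩

/-! ### Satisfaction of first-order formulas -/

theorem KripkeCategory.sat_ofFirstOrder {L : FirstOrder.Language.{u, v}}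
    (C : KripkeCategory.{u, v, w, x} L) {α : Type y} (W : C.World) (ν : α → C.carrier W) :
    ∀ {n : ℕ} (θ : L.BoundedFormula α n) (xs : Fin n → C.carrier W),
      C.Sat W (.ofFirstOrder θ) ν xs ↔ θ.Realize ν xs
  | _, .falsum, _ => Iff.rfl
  | _, .equal _ _, _ => Iff.rfl
  | _, .rel _ _, _ => Iff.rfl
  | _, .imp θ χ, xs => imp_congr (sat_ofFirstOrder C W ν θ xs) (sat_ofFirstOrder C W ν χ xs)
  | _, .all θ, _ => forall_congr' fun _ => sat_ofFirstOrder C W ν θ _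

theorem KripkeCategory.sat_relabel {L : FirstOrder.Language.{u, v}}
    (C : KripkeCategory.{u, v, w, x} L) {α : Type y} {β : Type*} (g : α → β) :
    ∀ {n : ℕ} (φ : ModalFormula L α n) (W : C.World) (ν : β → C.carrier W)
      (xs : Fin n → C.carrier W), C.Sat W (φ.relabel g) ν xs ↔ C.Sat W φ (ν ∘ g) xs
  | _, .falsum, _, _, _ => Iff.rfl
  | _, .equal _ _, W, ν, xs => by
      simp [ModalFormula.relabel, Sat, Sum.elim_comp_map]
  | _, .rel _ _, W, ν, xs => by
      simp [ModalFormula.relabel, Sat, Sum.elim_comp_map]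
  | _, .imp φ χ, W, ν, xs => imp_congr (sat_relabel C g φ W ν xs) (sat_relabel C g χ W ν xs)
  | _, .all φ, W, ν, _ => forall_congr' fun _ => sat_relabel C g φ W ν _
  | _, .box φ, _, ν, xs => forall_congr' fun U => forall₂_congr fun f _ =>
      sat_relabel C g φ U (f ∘ ν) (f ∘ xs)

/-! ### First-order definability of kernels and finite cardinalities -/

open FirstOrder.Language in
theorem exists_formula_realize_iff_ker_eq {n : ℕ} (π : Setoid (Fin n)) :
    ∃ θ : FirstOrder.Language.empty.Formula (Fin n), ∀ (U : Sets.{u}.World)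
      (f : Fin n → Sets.carrier U), θ.Realize f ↔ Setoid.ker f = π := by
  classical
  let E : Fin n × Fin n → FirstOrder.Language.empty.Formula (Fin n) := fun p =>
    (Term.var p.1).equal (Term.var p.2)
  refine ⟨Formula.iInf fun p => if π p.1 p.2 then E p else ∼(E p), fun U f => ?_⟩
  rw [Formula.realize_iInf]
  have key : ∀ p : Fin n × Fin n, (if π p.1 p.2 then E p else ∼(E p)).Realize f ↔
      (f p.1 = f p.2 ↔ π p.1 p.2) := by
    intro p
    by_cases hp : π p.1 p.2 <;> simp [hp, E]
  simp only [key, Prod.forall]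
  exact ⟨fun H => Setoid.ext H, fun H x y => by rw [← H]; rfl⟩

open FirstOrder.Language in
theorem exists_formula_realize_iff_mk_eq (α : Type y) (N : ℕ) :
    ∃ θ : FirstOrder.Language.empty.Formula α, ∀ (U : Sets.{u}.World)
      (f : α → Sets.carrier U), θ.Realize f ↔ Cardinal.mk (Sets.carrier U) = N := by
  let G : ℕ → FirstOrder.Language.empty.Formula α := fun k =>
    Formula.relabel Empty.elim (Sentence.cardGe FirstOrder.Language.empty k)
  have hG : ∀ (k : ℕ) (U : Sets.{u}.World) (f : α → Sets.carrier U),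
      (G k).Realize f ↔ (k : Cardinal) ≤ Cardinal.mk (Sets.carrier U) := by
    intro k U f
    rw [← Sentence.realize_cardGe (L := FirstOrder.Language.empty), Sentence.Realize,
      Formula.realize_relabel, Subsingleton.elim (f ∘ Empty.elim) default]
  refine ⟨G N ⊓ ∼(G (N + 1)), fun U f => ?_⟩
  rw [Formula.realize_inf, Formula.realize_not, hG, hG, not_le, Nat.cast_succ,
    ← Cardinal.succ_natCast, Order.lt_succ_iff, eq_comm, le_antisymm_iff]

/-! ### Cardinalities as codes -/

/-- The element of `K` that the cardinality of `U` codes, where `s k` is the cardinality coding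
`k`; it is `none` when the cardinality of `U` is not among the values of `s`. -/
noncomputable def sizeCode {K : Type w} (s : K → ℕ) (U : Type u) : Option K :=
  open Classical in
  if h : ∃ k, Cardinal.mk U = s k then some h.choose else none

theorem sizeCode_eq_some_iff {K : Type w} {s : K → ℕ} (hs : Function.Injective s) {U : Type u}
    {k : K} : sizeCode s U = some k ↔ Cardinal.mk U = s k := by
  unfold sizeCode
  constructor
  · intro H
    split_ifs at H with h
    rw [← Option.some_inj.1 H]
    exact h.choose_spec
  · intro H
    have h : ∃ k, Cardinal.mk U = s k := ⟨k, H⟩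
    rw [dif_pos h, Option.some_inj]
    exact hs (Nat.cast_injective (R := Cardinal.{u}) (h.choose_spec.symm.trans H))

theorem sizeCode_eq_none_iff {K : Type w} {s : K → ℕ} {U : Type u} :
    sizeCode s U = none ↔ ∀ k, Cardinal.mk U ≠ s k := by
  simp [sizeCode]

open FirstOrder.Language in
theorem exists_formula_realize_iff_sizeCode_eq (α : Type y) {K : Type w} [Finite K] {s : K → ℕ}
    (hs : Function.Injective s) (o : Option K) :
    ∃ θ : FirstOrder.Language.empty.Formula α, ∀ (U : Sets.{u}.World)
      (f : α → Sets.carrier U), θ.Realize f ↔ sizeCode s (Sets.carrier U) = o := by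
  choose θ hθ using exists_formula_realize_iff_mk_eq.{u, y} α
  cases o with
  | none =>
    refine ⟨Formula.iInf fun k => ∼(θ (s k)), fun U f => ?_⟩
    simp only [Formula.realize_iInf, Formula.realize_not, hθ, sizeCode_eq_none_iff, ne_eq]
  | some k => exact ⟨θ (s k), fun U f => by rw [hθ, sizeCode_eq_some_iff hs]⟩

open FirstOrder.Language in
/-- Every property of a map `f : Fin n → U` that depends only on the kernel of `f` and on the
element of a finite set coded by the cardinality of `U` is first-order definable in the language
of equality. -/
theorem exists_formula_realize_iff {n : ℕ} {K : Type w} [Finite K] {s : K → ℕ}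
    (hs : Function.Injective s) (A : Setoid (Fin n) → Option K → Prop) :
    ∃ θ : FirstOrder.Language.empty.Formula (Fin n), ∀ (U : Sets.{u}.World)
      (f : Fin n → Sets.carrier U),
      θ.Realize f ↔ A (Setoid.ker f) (sizeCode s (Sets.carrier U)) := by
  choose θ hθ using exists_formula_realize_iff_ker_eq.{u} (n := n)
  choose χ hχ using exists_formula_realize_iff_sizeCode_eq.{u} (Fin n) hs
  have : Finite (Setoid (Fin n)) :=
    Finite.of_injective (fun π x y => π x y) fun π ρ h =>
      Setoid.ext fun x y => iff_of_eq (congrFun₂ h x y)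
  refine ⟨Formula.iSup fun t : {t : Setoid (Fin n) × Option K // A t.1 t.2} =>
    θ t.1.1 ⊓ χ t.1.2, fun U f => ?_⟩
  simp only [Formula.realize_iSup, Formula.realize_inf, hθ, hχ]
  constructor
  · rintro ⟨⟨⟨_, _⟩, h⟩, rfl, rfl⟩
    exact h
  · exact fun h => ⟨⟨(_, _), h⟩, rfl, rfl⟩

/-! ### Valid formulas belong to `Prepartition n` -/

/-- A formula that fails at some node of a partition prelattice of an `n`-element set has a
first-order substitution instance that fails at an `n`-element set. -/
theorem exists_not_trueAt_subst {n : ℕ} (hn : 0 < n) {W₀ : Sets.{u}.World}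
    (a : Fin n ≃ Sets.carrier W₀) {φ : PropFormula} {Q : Type v} [Preorder Q]
    (hQ : IsPartitionPrelattice (Fin n) Q) {V : ℕ → Q → Prop} {q : Q}
    (hq : ¬ φ.Holds (fun p q : Q => p ≤ q) V q) :
    ∃ θ : ℕ → FirstOrder.Language.empty.Formula (Fin n),
      ¬ Sets.TrueAt W₀ (φ.subst fun i => (ModalFormula.ofFirstOrder (θ i)).relabel a) := by
  obtain ⟨c, hc, hle⟩ := isPartitionPrelattice_iff.1 hQ
  -- The kinds of nodes within a cluster, coded by cardinalities larger than `n`.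
  let K : Type := {i // i ∈ φ.vars} → Prop
  let s : K → ℕ := fun k => n + 1 + Finite.equivFin K k
  have hs : Function.Injective s := fun k l h =>
    (Finite.equivFin K).injective (Fin.ext (Nat.add_left_cancel h))
  -- A node in the cluster of `π`, of kind `k` if there is one.
  have hg : ∀ (π : Setoid (Fin n)) (k : K), ∃ r : Q, c r = π ∧
      ((∃ r', c r' = π ∧ ∀ i, V i.1 r' ↔ k i) → ∀ i, V i.1 r ↔ k i) := by
    intro π k
    by_cases h : ∃ r', c r' = π ∧ ∀ i, V i.1 r' ↔ k i
    · obtain ⟨r, hr, hrk⟩ := h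
      exact ⟨r, hr, fun _ => hrk⟩
    · obtain ⟨r, hr⟩ := hc π
      exact ⟨r, hr, fun h' => absurd h' h⟩
  choose g hgc hgk using hg
  have hg₀ : ∀ π : Setoid (Fin n), ∃ r : Q, c r = π ∧ (π = c q → r = q) := by
    intro π
    by_cases h : π = c q
    · exact ⟨q, h.symm, fun _ => rfl⟩
    · obtain ⟨r, hr⟩ := hc π
      exact ⟨r, hr, fun h' => absurd h' h⟩
  choose g₀ hg₀c hg₀q using hg₀
  let G : Setoid (Fin n) → Option K → Q := fun π o => o.elim (g₀ π) (g π)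
  have hGc : ∀ π o, c (G π o) = π := by
    rintro π (_ | k)
    exacts [hg₀c π, hgc π k]
  choose θ hθ using fun i => exists_formula_realize_iff.{u} hs
    fun (π : Setoid (Fin n)) o => V i (G (π ⊔ c q) o)
  let node : ∀ U : Sets.{u}.World, (Sets.carrier W₀ → Sets.carrier U) → Q :=
    fun U f => G (Setoid.ker (f ∘ a) ⊔ c q) (sizeCode s (Sets.carrier U))
  have transfer := sat_subst_iff_holds V
    (fun i => (ModalFormula.ofFirstOrder (θ i)).relabel a) node φ.vars ?atom ?forth ?back
    φ subset_rfl W₀ id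
  case atom =>
    intro i _ U f
    rw [KripkeCategory.sat_relabel, KripkeCategory.sat_ofFirstOrder]
    have := hθ i U (f ∘ a)
    rwa [FirstOrder.Language.Formula.Realize,
      Subsingleton.elim (default : Fin 0 → Sets.carrier U) Fin.elim0] at this
  case forth =>
    intro U U' f h
    rw [← hle, hGc, hGc]
    exact sup_le_sup_right (ker_le_ker_comp (f ∘ a) h) _
  case back =>
    intro U f r hr
    rw [← hle, hGc, sup_le_iff] at hr
    let k : K := fun i => V i.1 r
    obtain ⟨g', hg'⟩ := exists_ker_eq.{u} (show n ≤ s k by simp only [s]; omega) (c r)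
    have : Nonempty (ULift.{u} (Fin (s k))) := ⟨g' ⟨0, hn⟩⟩
    obtain ⟨h, hh⟩ := exists_comp_eq_of_ker_le (f := f ∘ a) (g := g') (hg'.symm ▸ hr.1)
    have hnode : node (ULift.{u} (Fin (s k))) (h ∘ f) = g (c r) k := by
      have hk : sizeCode s (ULift.{u} (Fin (s k))) = some k :=
        (sizeCode_eq_some_iff hs).2 (by simp)
      change G (Setoid.ker (h ∘ f ∘ a) ⊔ c q) (sizeCode s (ULift.{u} (Fin (s k)))) = _
      rw [hk, hh, hg', sup_eq_left.2 hr.2]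
      rfl
    refine ⟨ULift.{u} (Fin (s k)), h, ?_⟩
    rw [hnode]
    refine ⟨(hle _ _).1 (hgc _ _).le, (hle _ _).1 (hgc _ _).ge, fun i hi => ?_⟩
    exact hgk (c r) k ⟨r, rfl, fun _ => Iff.rfl⟩ ⟨i, hi⟩
  -- The cardinality `n` of `W₀` codes nothing and the identity has trivial kernel.
  have hroot : node W₀ id = q := by
    have hnone : sizeCode s (Sets.carrier W₀) = none := by
      refine sizeCode_eq_none_iff.2 fun k hk => ?_
      have hcard : Cardinal.mk (Sets.carrier W₀) = n := by
        simpa using (Cardinal.mk_congr_lift a).symm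
      have : n = s k := Nat.cast_injective (R := Cardinal.{u}) (hcard.symm.trans hk)
      simp only [s] at this
      omega
    have hker : Setoid.ker (id ∘ a) = (⊥ : Setoid (Fin n)) :=
      (Setoid.injective_iff_ker_bot _).1 a.injective
    change G (Setoid.ker (id ∘ a) ⊔ c q) (sizeCode s (Sets.carrier W₀)) = q
    rw [hnone, hker, bot_sup_eq]
    exact hg₀q _ rfl
  rw [hroot] at transfer
  exact ⟨θ, fun H => hq (transfer.1 H)⟩

end ModalModelTheory

theorem mainTheorem2 (n : ℕ) (hn : 0 < n)
    (W₀ : ModalModelTheory.Sets.{u}.World) (hW₀ : Nat.card (ModalModelTheory.Sets.carrier W₀) = n)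
    (𝓛 : ∀ k : ℕ, Set (ModalModelTheory.ModalFormula FirstOrder.Language.empty (Fin k) 0))
    (h𝓛 : ∀ (k : ℕ) (θ : FirstOrder.Language.empty.Formula (Fin k)),
      ModalModelTheory.ModalFormula.ofFirstOrder θ ∈ 𝓛 k) :
    ModalModelTheory.Sets.Val W₀ (ModalModelTheory.Sets.withParameters W₀ 𝓛) =
      ModalModelTheory.Prepartition.{v} n := by
  have : Finite (ModalModelTheory.Sets.carrier W₀) := Nat.finite_of_card_ne_zero (by omega)
  let a : Fin n ≃ ModalModelTheory.Sets.carrier W₀ := (Finite.equivFinOfCardEq hW₀).symm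
  ext φ
  constructor
  · intro hφ Q _ hQ V q
    by_contra hq
    obtain ⟨θ, hθ⟩ := ModalModelTheory.exists_not_trueAt_subst hn a hQ hq
    exact hθ (hφ _ fun i => ⟨n, _, a, h𝓛 n (θ i), rfl⟩)
  · exact fun hφ ψ _ => ModalModelTheory.trueAt_subst_of_mem_prepartition hn a hφ ψ
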